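/- Let $\mathbb{N}$ be the set of positive integers, let $m \in \mathbb{N}$ and write $[m] = \{1,\ldots,m\}$. Let $\mathbb{N}^{(\le m)}$ be the collection of all subsets of $\mathbb{N}$ of cardinality at most $m$ (including the empty set), and let $W : \mathbb{N}^{(\le m)} \to \mathbb{N}$ be an arbitrary function. For integers $x_1,\ldots,x_m \ge 1$ let $FEP_W(x_1,\ldots,x_m)$ be the set of all integers of the form $$\prod_{i \in B} x_i^{e_i},$$ where $B$ is a non-empty subset of $[m]$ and where, for each $i \in B$, the exponent $e_i$ is of the form $$e_i = \prod_{j \in [m] \setminus B,\ j > i} x_j^{p_{i,j}}, \qquad p_{i,j} \in \mathbb{Z},\quad 0 \le p_{i,j} \le W(\{x_{j+1},\ldots,x_m\}),$$ for some choice of the $p_{i,j}$ (an empty product is $1$, and $\{x_{j+1},\ldots,x_m\} = \emptyset$ for $j = m$). Then for every finite set $X$ and every colouring $f : \mathbb{N} \to X$ there exist integers $x_1,\ldots,x_m > 1$ such that $f$ is constant on $FEP_W(x_1,\ldots,x_m)$. -/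

import Mathlib

/-- A set `A` of natural numbers is monochromatic for the colouring `f` if `f` is constant on it. -/
def IsMonochromatic {X : Type*} (f : ℕ → X) (A : Set ℕ) : Prop :=
  ∃ c : X, ∀ n ∈ A, f n = c

/-- Weight functions: functions to `ℕ` on the subsets of `ℕ` of cardinality at most `m`. -/
abbrev WeightFun (m : ℕ) : Type :=
  {A : Finset ℕ // A.card ≤ m} → ℕ

/-- The set `{x_{i+1}, …, x_m}` of the terms of the tuple `x` that come after `x_i`,
as a subset of `ℕ` of cardinality at most `m`. -/
def laterTerms {m : ℕ} (x : Fin m → ℕ) (i : Fin m) : {A : Finset ℕ // A.card ≤ m} :=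
  ⟨(Finset.Ioi i).image x,
    Finset.card_image_le.trans ((Finset.card_le_univ _).trans_eq (Fintype.card_fin m))⟩

/-- The `W`-weighted products of `x_1, …, x_m` supported on the index set `S`: the numbers
`∏_{i ∈ S} x_i ^ p_i` with `0 ≤ p_i ≤ W {x_{i+1}, …, x_m}` for each `i ∈ S`. -/
def weightedFP {m : ℕ} (W : WeightFun m) (S : Finset (Fin m)) (x : Fin m → ℕ) : Set ℕ :=
  {n | ∃ p : Fin m → ℕ, (∀ i ∈ S, p i ≤ W (laterTerms x i)) ∧ n = ∏ i ∈ S, x i ^ p i}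

/-- The finite exponential-product set generated by `x_1, …, x_m` with weight `W`: the numbers
`∏_{i ∈ B} x_i ^ e_i` with `B` a non-empty set of indices and, for each `i ∈ B`, the exponent
`e_i` a `W`-weighted product supported on the indices `j > i` that are not in `B`. -/
def FEP {m : ℕ} (W : WeightFun m) (x : Fin m → ℕ) : Set ℕ :=
  {n | ∃ (B : Finset (Fin m)) (e : Fin m → ℕ), B.Nonempty ∧
    (∀ i ∈ B, e i ∈ weightedFP W (Finset.Ioi i \ B) x) ∧ n = ∏ i ∈ B, x i ^ e i}

/-! Put `x i = 2 ^ n i` and colour exponents by `n ↦ f (2 ^ n)`: an element of `FEP` becomes a sum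
of terms `n i * 2 ^ (∑ j, n j * p i j)`. Iterating Gallai's theorem gives a sequence `z` for which
such inner exponents do not affect the colour (`exists_sequence_colour_eq_of_coSpan`), so only the
set of selected indices matters. The finite unions theorem (`exists_ordered_blocks`) then yields
blocks of indices whose unions all have one colour, and `n i` is the sum of `z` over a block. -/

/-! ### Gallai's theorem. -/

open Finset in
/-- A finitary form of Gallai's theorem: the dilation factor and the translation vector are bounded
independently of the colouring. -/
theorem exists_bounded_mono_homothetic_cube (η κ : Type*) [Finite η] [Finite κ] (P : ℕ) :
    ∃ H : ℕ, ∀ C : (η → ℕ) → κ, ∃ h : ℕ, 0 < h ∧ h ≤ H ∧ ∃ q : η → ℕ, (∀ i, q i ≤ H * P) ∧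
      ∀ p : η → ℕ, (∀ i, p i ≤ P) → C (fun i => q i + h * p i) = C q := by
  classical
  -- Summing the letters of a word turns a combinatorial line into a homothetic cube, dilated by the
  -- number of active coordinates. The word length gives both bounds.
  obtain ⟨ι, _, hι⟩ := Combinatorics.Line.exists_mono_in_high_dimension (η → Fin (P + 1)) κ
  refine ⟨Fintype.card ι, fun C => ?_⟩
  obtain ⟨l, c, hl⟩ := hι fun w => C fun i => ∑ j, (w j i : ℕ)
  have key : ∀ x : η → Fin (P + 1), ∀ i, ∑ j, (l x j i : ℕ) =
      ∑ j, (l (fun _ => 0) j i : ℕ) + #{j | l.idxFun j = none} * (x i : ℕ) := by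
    intro x i
    rw [Finset.card_filter, Finset.sum_mul, ← Finset.sum_add_distrib]
    refine Finset.sum_congr rfl fun j _ => ?_
    rcases hj : l.idxFun j with _ | a <;> simp only [Combinatorics.Line.coe_apply, hj] <;> simp
  refine ⟨#{j | l.idxFun j = none}, ?_, Finset.card_le_univ _,
    fun i => ∑ j, (l (fun _ => 0) j i : ℕ), fun i => ?_, fun p hp => ?_⟩
  · obtain ⟨j, hj⟩ := l.proper
    exact Finset.card_pos.mpr ⟨j, by simpa using hj⟩
  · calc ∑ j, (l (fun _ => 0) j i : ℕ) ≤ ∑ _j : ι, P :=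
          Finset.sum_le_sum fun j _ => Nat.le_of_lt_succ (Fin.is_lt _)
      _ = Fintype.card ι * P := by rw [Finset.sum_const, Finset.card_univ, smul_eq_mul]
  · have h1 := hl fun i => ⟨p i, Nat.lt_succ_of_le (hp i)⟩
    have h2 := hl fun _ => 0
    exact (congrArg C (funext fun i => (key _ i).symm)).trans (h1.trans h2.symm)

/-! ### Sequences insensitive to exponents. -/

/-- The sum of the `z i * 2 ^ e i` over those `i < L` that are selected by `I`. -/
def twistedSum (L : ℕ) (z : ℕ → ℕ) (I : ℕ → Bool) (e : ℕ → ℕ) : ℕ :=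
  ∑ i ∈ Finset.range L, if I i then z i * 2 ^ e i else 0

/-- The combination with coefficients `p i k` of those `z k` with `k < i` that are not selected
by `I`. -/
def coSpan (z : ℕ → ℕ) (I : ℕ → Bool) (p : ℕ → ℕ → ℕ) (i : ℕ) : ℕ :=
  ∑ k ∈ Finset.range i, if I k then 0 else p i k * z k

theorem twistedSum_congr {L : ℕ} {z z' e e' : ℕ → ℕ} {I : ℕ → Bool}
    (h : ∀ i < L, z i * 2 ^ e i = z' i * 2 ^ e' i) : twistedSum L z I e = twistedSum L z' I e' :=
  Finset.sum_congr rfl fun i hi => by rw [h i (Finset.mem_range.mp hi)]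

theorem twistedSum_succ (L : ℕ) (z : ℕ → ℕ) (I : ℕ → Bool) (e : ℕ → ℕ) :
    twistedSum (L + 1) z I e = (if I 0 then z 0 * 2 ^ e 0 else 0) +
      twistedSum L (fun i => z (i + 1)) (fun i => I (i + 1)) (fun i => e (i + 1)) := by
  rw [twistedSum, Finset.sum_range_succ', add_comm]
  rfl

theorem coSpan_succ (z : ℕ → ℕ) (I : ℕ → Bool) (p : ℕ → ℕ → ℕ) (i : ℕ) :
    coSpan z I p (i + 1) = (if I 0 then 0 else p (i + 1) 0 * z 0) +
      coSpan (fun k => z (k + 1)) (fun k => I (k + 1)) (fun j k => p (j + 1) (k + 1)) i := by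
  rw [coSpan, Finset.sum_range_succ', add_comm]
  rfl

/-- There are arbitrarily long sequences `z` for which the colour of a sum of the terms
`z i * 2 ^ d i`, `i ∈ I`, does not depend on the exponents `d i`, as long as these are combinations
of earlier terms with indices outside `I`, with coefficients bounded in terms of the preceding
terms. -/
theorem exists_sequence_colour_eq_of_coSpan {X : Type*} [Finite X] (f : ℕ → X) (L : ℕ) :
    ∀ (V : ℕ → ℕ), Monotone V → ∀ E M : ℕ, ∃ z : ℕ → ℕ, (∀ i, 0 < z i) ∧
      ∀ (I : ℕ → Bool) (e : ℕ → ℕ), (∀ i, e i ≤ E) → ∀ b ≤ M, ∀ p : ℕ → ℕ → ℕ,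
        (∀ i k, p i k ≤ V (∑ j ∈ Finset.range k, z j)) →
        f (b + twistedSum L z I (fun i => e i + coSpan z I p i)) = f (b + twistedSum L z I e) := by
  induction L with
  | zero => exact fun V _ E M => ⟨fun _ => 1, fun _ => one_pos, fun _ _ _ _ _ _ _ => rfl⟩
  | succ L ih =>
    intro V hV E M
    obtain ⟨H, hH⟩ := exists_bounded_mono_homothetic_cube (Fin L)
      ((Fin L → Bool) → (Fin L → Fin (E + 1)) → Fin (M + 1) → X) (V 0)
    set Q := H * V 0 with hQ
    -- The tail `z` precedes `h` and `q`, since the colouring that determines them involves `z`;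
    -- hence the need for the uniform bounds `H` and `Q`. One `Q` allows for `q i`, the other for `h
    -- * r i`, and `H * 2 ^ E` for a selected first term.
    obtain ⟨z, hz, hzf⟩ := ih (fun S => 2 ^ Q * V (H + 2 ^ Q * S))
      (fun a b hab => Nat.mul_le_mul_left _
        (hV (Nat.add_le_add_left (Nat.mul_le_mul_left _ hab) _))) (E + Q + Q) (M + H * 2 ^ E)
    obtain ⟨h, h0, hhH, q₀, hq₀, hC⟩ := hH fun q I e b =>
      f (b + ∑ i : Fin L, if I i then z i * 2 ^ ((e i : ℕ) + q i) else 0)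
    set q : ℕ → ℕ := fun i => if hi : i < L then q₀ ⟨i, hi⟩ else 0 with hqdef
    have hqQ : ∀ i, q i ≤ Q := by
      intro i
      simp only [hqdef]
      split_ifs
      · exact hq₀ _
      · exact Nat.zero_le _
    have hq : ∀ i : Fin L, q i = q₀ i := fun i => by simp [hqdef]
    have hC' : ∀ (I : ℕ → Bool) (e : ℕ → ℕ), (∀ i, e i ≤ E) → ∀ b ≤ M, ∀ r : ℕ → ℕ,
        (∀ i, r i ≤ V 0) → f (b + twistedSum L z I (fun i => e i + (q i + h * r i))) =
          f (b + twistedSum L z I (fun i => e i + q i)) := by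
      intro I e he b hb r hr
      have := congrFun (congrFun (congrFun (hC (fun i => r i) fun i => hr i) fun i => I i)
        fun i => ⟨e i, Nat.lt_succ_of_le (he i)⟩) ⟨b, Nat.lt_succ_of_le hb⟩
      simpa only [twistedSum, Finset.sum_range, hq] using this
    -- The factors `2 ^ q i` move the exponents to the corner of the monochromatic cube, where
    -- adding bounded multiples of the new first term `h` keeps the colour.
    let z' : ℕ → ℕ := fun i => Nat.casesOn i h fun i => z i * 2 ^ q i
    refine ⟨z', fun i => ?_, fun I e he b hb p hp => ?_⟩
    · cases i with
      | zero => exact h0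
      | succ i => exact Nat.mul_pos (hz i) (by positivity)
    have hsum : ∀ k, ∑ j ∈ Finset.range (k + 1), z' j ≤ H + 2 ^ Q * ∑ j ∈ Finset.range k, z j := by
      intro k
      rw [Finset.sum_range_succ', add_comm, Finset.mul_sum]
      refine add_le_add hhH (Finset.sum_le_sum fun j _ => ?_)
      rw [mul_comm (2 ^ Q)]
      exact Nat.mul_le_mul_left _ (Nat.pow_le_pow_right two_pos (hqQ j))
    set I' : ℕ → Bool := fun i => I (i + 1) with hI'
    set p' : ℕ → ℕ → ℕ := fun i k => p (i + 1) (k + 1) * 2 ^ q k with hp'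
    set r : ℕ → ℕ := fun i => if I 0 then 0 else p (i + 1) 0 with hr
    have hr0 : ∀ i, r i ≤ V 0 := by
      intro i
      simp only [hr]
      split_ifs
      · exact Nat.zero_le _
      · simpa using hp (i + 1) 0
    have hco : ∀ i, coSpan z' I p (i + 1) = h * r i + coSpan z I' p' i := by
      intro i
      rw [coSpan_succ]
      congr 1
      · simp only [hr]
        split_ifs
        · rfl
        · exact mul_comm _ _
      · refine Finset.sum_congr rfl fun k _ => ?_
        simp only [hp', hI', z']
        split_ifs
        · rfl
        · ring
    have h1 : twistedSum (L + 1) z' I (fun i => e i + coSpan z' I p i) =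
        (if I 0 then h * 2 ^ e 0 else 0) +
          twistedSum L z I' (fun i => (e (i + 1) + (q i + h * r i)) + coSpan z I' p' i) := by
      rw [twistedSum_succ]
      congr 1
      refine twistedSum_congr fun i _ => ?_
      rw [hco]
      simp only [z']
      ring
    have h2 : twistedSum (L + 1) z' I e = (if I 0 then h * 2 ^ e 0 else 0) +
          twistedSum L z I' (fun i => e (i + 1) + q i) := by
      rw [twistedSum_succ]
      congr 1
      refine twistedSum_congr fun i _ => ?_
      simp only [z']
      ring
    have hb' : b + (if I 0 then h * 2 ^ e 0 else 0) ≤ M + H * 2 ^ E := by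
      refine add_le_add hb ?_
      split_ifs
      · exact Nat.mul_le_mul hhH (Nat.pow_le_pow_right two_pos (he 0))
      · exact Nat.zero_le _
    rw [h1, h2, ← add_assoc, ← add_assoc, hzf I' _ _ _ hb']
    -- A selected `h` sits in the constant and in no exponent; an unselected `h` occurs only in
    -- exponents, where the cube removes it.
    · by_cases hI0 : I 0
      · simp [hr, hI0]
      · simp only [hI0]
        exact hC' I' (fun i => e (i + 1)) (fun i => he _) b hb r hr0
    · intro i k
      simp only [hp']
      rw [mul_comm]
      exact Nat.mul_le_mul (Nat.pow_le_pow_right two_pos (hqQ k))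
        ((hp _ _).trans (hV (hsum k)))
    · intro i
      have := hqQ i
      have := he (i + 1)
      have := Nat.mul_le_mul hhH (hr0 i)
      lia

/-! ### Finite unions. -/

/-- Finite unions theorem, with the blocks in increasing order. -/
theorem exists_ordered_blocks_infinite {X : Type*} [Finite X] (c : Finset ℕ → X) :
    ∃ J : ℕ → Finset ℕ, (∀ i, (J i).Nonempty) ∧ (∀ i j, i < j → ∀ a ∈ J i, ∀ b ∈ J j, a < b) ∧
      ∃ x, ∀ B : Finset ℕ, B.Nonempty → c (B.biUnion J) = x := by
  classical
  -- Words remember order: ordered products of generators are increasing words, so `b i * b j` being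
  -- increasing orders the blocks.
  let S : FreeMonoid ℕ → Finset ℕ := fun w => w.toList.toFinset
  have hS : ∀ v w, S (v * w) = S v ∪ S w := fun v w => by simp [S]
  have hFP : ∀ (a : Stream' (FreeMonoid ℕ)) (w : FreeMonoid ℕ), w ∈ Hindman.FP a →
      ∀ n, (∀ k, a.get k = FreeMonoid.of (n + k)) →
        w.toList ≠ [] ∧ w.toList.Pairwise (· < ·) ∧ ∀ k ∈ w.toList, n ≤ k := by
    intro a w hw
    induction hw with
    | head' a =>
      intro n hn
      have : a.head = FreeMonoid.of n := hn 0
      simp [this]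
    | tail' a w _ ih =>
      intro n hn
      obtain ⟨h1, h2, h3⟩ := ih (n + 1) fun k => by
        rw [Stream'.get_tail, hn]; congr 1; ring
      exact ⟨h1, h2, fun k hk => by have := h3 k hk; lia⟩
    | cons' a w _ ih =>
      intro n hn
      obtain ⟨h1, h2, h3⟩ := ih (n + 1) fun k => by
        rw [Stream'.get_tail, hn]; congr 1; ring
      have : a.head = FreeMonoid.of n := hn 0
      rw [this]
      refine ⟨by simp, ?_, ?_⟩
      · simpa using ⟨fun k hk => h3 k hk, h2⟩
      · simp only [FreeMonoid.toList_mul, FreeMonoid.toList_of, List.singleton_append,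
          List.mem_cons]
        rintro k (rfl | hk)
        · exact le_rfl
        · have := h3 k hk; lia
  let a : Stream' (FreeMonoid ℕ) := fun n => FreeMonoid.of n
  obtain ⟨s, ⟨x, rfl⟩, b, hb⟩ := Hindman.FP_partition_regular a
    (Set.range fun x => {w | w ∈ Hindman.FP a ∧ c (S w) = x}) (Set.finite_range _)
    fun w hw => ⟨_, ⟨c (S w), rfl⟩, hw, rfl⟩
  have hba : ∀ w ∈ Hindman.FP b,
      w.toList ≠ [] ∧ w.toList.Pairwise (· < ·) ∧ ∀ k ∈ w.toList, 0 ≤ k :=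
    fun w hw => hFP a w (hb hw).1 0 fun k => by simp [a, Stream'.get]
  refine ⟨fun i => S (b.get i), fun i => ?_, fun i j hij k hk l hl => ?_, x, fun B hB => ?_⟩
  · simpa [S, List.toFinset_nonempty_iff] using (hba _ (Hindman.FP.singleton b i)).1
  · have := (hba _ (Hindman.FP.mul_two b i j hij)).2.1
    rw [FreeMonoid.toList_mul, List.pairwise_append] at this
    exact this.2.2 k (by simpa [S] using hk) l (by simpa [S] using hl)
  · have key : ∀ B : Finset ℕ, B.Nonempty → ∀ n, (∀ i ∈ B, n ≤ i) →
        ∃ w ∈ Hindman.FP (b.drop n), S w = B.biUnion fun i => S (b.get i) := by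
      intro B
      have hmono : ∀ {n m}, n ≤ m → Hindman.FP (b.drop m) ⊆ Hindman.FP (b.drop n) := by
        intro n m hnm
        obtain ⟨d, rfl⟩ := Nat.exists_eq_add_of_le hnm
        rw [← Stream'.drop_drop]
        exact Hindman.FP_drop_subset_FP _ _
      induction B using Finset.induction_on_min with
      | empty => exact fun h => absurd h Finset.not_nonempty_empty
      | insert i B hi ih =>
        intro _ n hn
        have hni := hn i (Finset.mem_insert_self _ _)
        rcases B.eq_empty_or_nonempty with rfl | hB
        · refine ⟨b.get i, hmono hni ?_, by simp⟩
          rw [← Stream'.head_drop]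
          exact Hindman.FP.head _
        · obtain ⟨w, hw, hwS⟩ := ih hB (i + 1) fun j hj => hi j hj
          refine ⟨b.get i * w, hmono hni ?_, by rw [hS, hwS, Finset.biUnion_insert]⟩
          rw [← Stream'.head_drop]
          refine Hindman.FP.cons _ _ ?_
          rwa [Stream'.tail_eq_drop, Stream'.drop_drop]
    obtain ⟨w, hw, hwS⟩ := key B hB 0 fun _ _ => Nat.zero_le _
    rw [← hwS]
    exact (hb hw).2

/-- Finitary finite unions theorem, with the blocks in increasing order. -/
theorem exists_ordered_blocks (X : Type*) [Finite X] (m : ℕ) :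
    ∃ L : ℕ, ∀ c : Finset ℕ → X, ∃ J : ℕ → Finset ℕ, (∀ i, (J i).Nonempty) ∧
      (∀ i j, i < j → ∀ a ∈ J i, ∀ b ∈ J j, a < b) ∧ (∀ i < m, J i ⊆ Finset.range L) ∧
      ∃ x, ∀ B ⊆ Finset.range m, B.Nonempty → c (B.biUnion J) = x := by
  classical
  by_contra! hcon
  choose c hc using hcon
  -- Compactness: an ultrafilter limit of the bad colourings agrees with some `c L` on the finitely
  -- many unions involved.
  have hlim : ∀ I : Finset ℕ, ∃ x, ∀ᶠ L in (Filter.hyperfilter ℕ : Filter ℕ), c L I = x := by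
    intro I
    obtain ⟨x, hx⟩ := ((Filter.hyperfilter ℕ).map fun L => c L I).eq_pure_of_finite
    refine ⟨x, ?_⟩
    have : {x} ∈ (Filter.hyperfilter ℕ).map fun L => c L I := by rw [hx]; rfl
    exact this
  choose d hd using hlim
  obtain ⟨J, hJ, hJlt, x, hx⟩ := exists_ordered_blocks_infinite d
  have h1 : ∀ᶠ L in (Filter.hyperfilter ℕ : Filter ℕ), ∀ B ∈ (Finset.range m).powerset,
      c L (B.biUnion J) = d (B.biUnion J) :=
    (Filter.eventually_all_finset _).mpr fun B _ => hd _
  have h2 : ∀ᶠ L in (Filter.hyperfilter ℕ : Filter ℕ),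
      (Finset.range m).biUnion J ⊆ Finset.range L := by
    refine Filter.Eventually.filter_mono Nat.hyperfilter_le_atTop ?_
    filter_upwards [Filter.eventually_gt_atTop (((Finset.range m).biUnion J).sup id)] with L hL k hk
    exact Finset.mem_range.mpr ((Finset.le_sup (f := id) hk).trans_lt hL)
  obtain ⟨L, hL1, hL2⟩ := (h1.and h2).exists
  obtain ⟨B, hBm, hB, hne⟩ := hc L J hJ hJlt
    (fun i hi => (Finset.subset_biUnion_of_mem J (Finset.mem_range.mpr hi)).trans hL2) x
  exact hne ((hL1 B (Finset.mem_powerset.mpr hBm)).trans (hx B hB))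

/-! ### Weights and conclusion. -/

/-- The largest weight of a set of numbers that are at most `2 ^ S`. -/
def maxWeight {m : ℕ} (W : WeightFun m) (S : ℕ) : ℕ :=
  (Finset.range (2 ^ S + 1)).powerset.sup fun A => if h : A.card ≤ m then W ⟨A, h⟩ else 0

theorem maxWeight_mono {m : ℕ} (W : WeightFun m) : Monotone (maxWeight W) := fun _ _ h =>
  Finset.sup_mono (Finset.powerset_mono.mpr (Finset.range_mono
    (Nat.succ_le_succ (Nat.pow_le_pow_right two_pos h))))

theorem le_maxWeight {m : ℕ} (W : WeightFun m) {S : ℕ} (A : {A : Finset ℕ // A.card ≤ m})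
    (hA : ∀ a ∈ A.1, a ≤ 2 ^ S) : W A ≤ maxWeight W S := by
  have hmem : A.1 ∈ (Finset.range (2 ^ S + 1)).powerset :=
    Finset.mem_powerset.mpr fun a ha => Finset.mem_range.mpr (Nat.lt_succ_of_le (hA a ha))
  have := Finset.le_sup (f := fun A : Finset ℕ => if h : A.card ≤ m then W ⟨A, h⟩ else 0) hmem
  rwa [dif_pos A.2] at this

theorem twistedSum_mem {L : ℕ} {U : Finset ℕ} (hU : U ⊆ Finset.range L) (z e : ℕ → ℕ) :
    twistedSum L z (fun l => decide (l ∈ U)) e = ∑ l ∈ U, z l * 2 ^ e l := by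
  simp only [twistedSum, decide_eq_true_eq]
  rw [Finset.sum_ite_mem, Finset.inter_eq_right.mpr hU]

theorem theorem4 (m : ℕ) (W : WeightFun m) {X : Type*} [Finite X] (f : ℕ → X) :
    ∃ x : Fin m → ℕ, (∀ i, 1 < x i) ∧ IsMonochromatic f (FEP W x) := by
  classical
  obtain ⟨L, hL⟩ := exists_ordered_blocks X m
  obtain ⟨z, hz, hzf⟩ := exists_sequence_colour_eq_of_coSpan (fun n => f (2 ^ n)) L
    (maxWeight W) (maxWeight_mono W) 0 0
  obtain ⟨J, hJ, hJlt, hJL, χ, hχ⟩ := hL fun I => f (2 ^ ∑ l ∈ I, z l)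
  -- Reversed, because the exponent of `x i` uses later `x j`, while `coSpan` uses earlier terms of
  -- `z`.
  let K : Fin m → Finset ℕ := fun i => J (Fin.rev i)
  have hKlt : ∀ i j, i < j → ∀ k ∈ K j, ∀ l ∈ K i, k < l := fun i j hij k hk l hl =>
    hJlt (Fin.rev j) (Fin.rev i) (Fin.rev_lt_rev.mpr hij) k hk l hl
  have hKuniq : ∀ i j l, l ∈ K i → l ∈ K j → i = j := by
    intro i j l hi hj
    rcases lt_trichotomy i j with h | h | h
    · exact absurd (hKlt i j h l hj l hi) (lt_irrefl _)
    · exact h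
    · exact absurd (hKlt j i h l hi l hj) (lt_irrefl _)
  have hKdisj : ∀ s : Set (Fin m), s.PairwiseDisjoint K := fun s i _ j _ hij =>
    Finset.disjoint_left.mpr fun l hi hj => hij (hKuniq i j l hi hj)
  let n : Fin m → ℕ := fun i => ∑ l ∈ K i, z l
  have hn : ∀ i, 0 < n i := fun i => Finset.sum_pos (fun l _ => hz l) (hJ _)
  refine ⟨fun i => 2 ^ n i, fun i => Nat.one_lt_two_pow (hn i).ne', χ, ?_⟩
  rintro _ ⟨B, e, hB, he, rfl⟩
  choose! p hpW hpe using he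
  let U := B.biUnion K
  have hUL : U ⊆ Finset.range L := Finset.biUnion_subset.mpr fun i _ => hJL _ (Fin.rev i).2
  -- At most one pair `(i, j)` contributes, so the supremum just reads off `p i j` on `K i × K j`
  -- and is `0` elsewhere, in particular at indices lying in no block.
  let r : ℕ → ℕ → ℕ := fun l k => B.sup fun i => (Finset.Ioi i \ B).sup fun j =>
    if l ∈ K i ∧ k ∈ K j then p i j else 0
  have hrV : ∀ l k, r l k ≤ maxWeight W (∑ t ∈ Finset.range k, z t) := by
    refine fun l k => Finset.sup_le fun i hi => Finset.sup_le fun j hj => ?_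
    split_ifs with h
    · refine (hpW i hi j hj).trans (le_maxWeight W _ fun a ha => ?_)
      obtain ⟨t, ht, rfl⟩ := Finset.mem_image.mp ha
      exact Nat.pow_le_pow_right two_pos (Finset.sum_le_sum_of_subset fun s hs =>
        Finset.mem_range.mpr (hKlt j t (Finset.mem_Ioi.mp ht) s hs k h.2))
    · exact Nat.zero_le _
  have hr : ∀ i ∈ B, ∀ l ∈ K i, ∀ j ∈ Finset.Ioi i \ B, ∀ k ∈ K j, r l k = p i j := by
    intro i hi l hl j hj k hk
    apply le_antisymm
    · refine Finset.sup_le fun i' _ => Finset.sup_le fun j' _ => ?_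
      split_ifs with h
      · rw [hKuniq i i' l hl h.1, hKuniq j j' k hk h.2]
      · exact Nat.zero_le _
    · refine le_trans ?_ (Finset.le_sup hi)
      refine le_trans ?_ (Finset.le_sup hj)
      rw [if_pos ⟨hl, hk⟩]
  have hr0 : ∀ i, ∀ l ∈ K i, ∀ k, k ∉ (Finset.Ioi i \ B).biUnion K → r l k = 0 := by
    refine fun i l hl k hk => Nat.le_zero.mp (Finset.sup_le fun i' _ => Finset.sup_le
      fun j' hj' => ?_)
    rw [if_neg]
    rintro ⟨h1, h2⟩
    rw [← hKuniq i i' l hl h1] at hj'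
    exact hk (Finset.mem_biUnion.mpr ⟨j', hj', h2⟩)
  have hco : ∀ i ∈ B, ∀ l ∈ K i, coSpan z (fun l => decide (l ∈ U)) r l =
      ∑ j ∈ Finset.Ioi i \ B, n j * p i j := by
    intro i hi l hl
    calc coSpan z (fun l => decide (l ∈ U)) r l
        = ∑ k ∈ (Finset.Ioi i \ B).biUnion K, r l k * z k := by
          simp only [coSpan, decide_eq_true_eq]
          symm
          refine Finset.sum_subset_zero_on_sdiff (fun k hk => ?_) (fun k hk => ?_)
            fun k hk => ?_
          · obtain ⟨j, hj, hkj⟩ := Finset.mem_biUnion.mp hk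
            exact Finset.mem_range.mpr
              (hKlt i j (Finset.mem_Ioi.mp (Finset.mem_sdiff.mp hj).1) k hkj l hl)
          · rw [hr0 i l hl k (Finset.mem_sdiff.mp hk).2]
            simp
          · rw [if_neg]
            intro hkU
            obtain ⟨j, hj, hkj⟩ := Finset.mem_biUnion.mp hk
            obtain ⟨j', hj', hkj'⟩ := Finset.mem_biUnion.mp hkU
            exact (Finset.mem_sdiff.mp hj).2 (hKuniq j j' k hkj hkj' ▸ hj')
      _ = ∑ j ∈ Finset.Ioi i \ B, n j * p i j := by
          rw [Finset.sum_biUnion (hKdisj _)]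
          refine Finset.sum_congr rfl fun j hj => ?_
          rw [Finset.sum_mul]
          exact Finset.sum_congr rfl fun k hk => by rw [hr i hi l hl j hj k hk, mul_comm]
  have hexp : ∏ i ∈ B, (2 ^ n i) ^ e i =
      2 ^ (0 + twistedSum L z (fun l => decide (l ∈ U))
        (fun l => 0 + coSpan z (fun l => decide (l ∈ U)) r l)) := by
    simp only [← pow_mul, Finset.prod_pow_eq_pow_sum, zero_add]
    rw [twistedSum_mem hUL, Finset.sum_biUnion (hKdisj _)]
    congr 1
    refine Finset.sum_congr rfl fun i hi => ?_
    rw [Finset.sum_mul]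
    refine Finset.sum_congr rfl fun l hl => ?_
    rw [hco i hi l hl, hpe i hi]
    simp only [← pow_mul, Finset.prod_pow_eq_pow_sum]
  have hUJ : U = (B.image fun i => (Fin.rev i : ℕ)).biUnion J := by
    rw [Finset.image_biUnion]
  rw [hexp]
  refine (hzf _ (fun _ => 0) (fun _ => le_rfl) 0 le_rfl r hrV).trans ?_
  rw [twistedSum_mem hUL, hUJ, zero_add]
  simp only [pow_zero, mul_one]
  refine hχ _ (fun t ht => ?_) (hB.image _)
  obtain ⟨i, _, rfl⟩ := Finset.mem_image.mp ht
  exact Finset.mem_range.mpr (Fin.rev i).2
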